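/- Let $\mathbb D$ be the open unit disc in $\mathbb C$ and $dA=dx\,dy/\pi$ the normalized area measure on $\mathbb D$. For $f$ analytic on $\mathbb D$ let $\mathcal D(f)=\int_{\mathbb D}|f'(z)|^2\,dA(z)\in[0,\infty]$, and let the Dirichlet space $\mathcal D$ be the space of all analytic functions $f$ on $\mathbb D$ with $\mathcal D(f)<\infty$, endowed with the norm $\|f\|_{\mathcal D}=\bigl(|f(0)|^2+\mathcal D(f)\bigr)^{1/2}$. Let $\varphi:\mathbb D\to\mathbb D$ be an analytic function with $\varphi\in\mathcal D$, let $\varphi^n$ denote its $n$-th pointwise power, $\varphi^n(z)=(\varphi(z))^n$, and let $C_\varphi f=f\circ\varphi$. (a) If $\sup_{n\ge 1}\mathcal D(\varphi^n)<\infty$, then $C_\varphi$ maps $\mathcal D$ into $\mathcal D$ and is a bounded operator on $\mathcal D$. (b) If $\lim_{n\to\infty}\mathcal D(\varphi^n)=0$, then $C_\varphi$ maps $\mathcal D$ into $\mathcal D$ and is a compact bounded operator on $\mathcal D$. -/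

import Mathlib

noncomputable section

namespace DirichletComposition

open MeasureTheory Metric
open scoped ENNReal Complex.UnitDisc

/-- The extension by zero to `ℂ` of a function on the open unit disc. -/
def zeroExtend (f : 𝔻 → ℂ) (z : ℂ) : ℂ :=
  if h : ‖z‖ < 1 then f (Complex.UnitDisc.mk z h) else 0

/-- `f` is analytic on the open unit disc. -/
def IsHolomorphic (f : 𝔻 → ℂ) : Prop :=
  DifferentiableOn ℂ (zeroExtend f) (ball 0 1)

/-- The normalized area measure `dA = dx dy / π` on the open unit disc. -/
def areaMeasure : Measure ℂ :=
  (ENNReal.ofReal Real.pi)⁻¹ • (volume : Measure ℂ).restrict (ball 0 1)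

/-- The Dirichlet integral `∫_𝔻 |f'|² dA`, with values in `[0, ∞]`. -/
def dirichletIntegral (f : 𝔻 → ℂ) : ℝ≥0∞ :=
  ∫⁻ z, ‖deriv (zeroExtend f) z‖ₑ ^ 2 ∂areaMeasure

/-- `f` belongs to the Dirichlet space. -/
def MemDirichlet (f : 𝔻 → ℂ) : Prop :=
  IsHolomorphic f ∧ dirichletIntegral f < ∞

theorem zeroExtend_coe (f : 𝔻 → ℂ) (z : 𝔻) : zeroExtend f (z : ℂ) = f z := by
  simp [zeroExtend, z.norm_lt_one]

theorem zeroExtend_zero : zeroExtend 0 = 0 := by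
  ext z; simp [zeroExtend]

theorem zeroExtend_add (f g : 𝔻 → ℂ) :
    zeroExtend (f + g) = zeroExtend f + zeroExtend g := by
  ext z; by_cases h : ‖z‖ < 1 <;> simp [zeroExtend, h]

theorem zeroExtend_smul (c : ℂ) (f : 𝔻 → ℂ) :
    zeroExtend (c • f) = c • zeroExtend f := by
  ext z; by_cases h : ‖z‖ < 1 <;> simp [zeroExtend, h]

theorem ae_mem_ball : ∀ᵐ z ∂areaMeasure, z ∈ ball (0 : ℂ) 1 :=
  Measure.ae_smul_measure (ae_restrict_mem measurableSet_ball) _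

theorem IsHolomorphic.differentiableAt {f : 𝔻 → ℂ} (hf : IsHolomorphic f) {z : ℂ}
    (hz : z ∈ ball (0 : ℂ) 1) : DifferentiableAt ℂ (zeroExtend f) z :=
  DifferentiableOn.differentiableAt hf (isOpen_ball.mem_nhds hz)

theorem deriv_add_ae {f g : 𝔻 → ℂ} (hf : IsHolomorphic f) (hg : IsHolomorphic g) :
    deriv (zeroExtend (f + g)) =ᵐ[areaMeasure]
      deriv (zeroExtend f) + deriv (zeroExtend g) := by
  filter_upwards [ae_mem_ball] with z hz
  rw [zeroExtend_add, deriv_add (hf.differentiableAt hz) (hg.differentiableAt hz)]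
  rfl

theorem deriv_smul_ae {f : 𝔻 → ℂ} (c : ℂ) (hf : IsHolomorphic f) :
    deriv (zeroExtend (c • f)) =ᵐ[areaMeasure] c • deriv (zeroExtend f) := by
  filter_upwards [ae_mem_ball] with z hz
  rw [zeroExtend_smul, deriv_const_smul _ (hf.differentiableAt hz)]
  rfl

theorem eLpNorm_sq (f : 𝔻 → ℂ) :
    eLpNorm (deriv (zeroExtend f)) 2 areaMeasure ^ 2 = dirichletIntegral f := by
  have := eLpNorm_nnreal_pow_eq_lintegral (f := deriv (zeroExtend f)) (μ := areaMeasure)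
    (p := 2) two_ne_zero
  simpa [dirichletIntegral] using this

theorem memLp_iff (f : 𝔻 → ℂ) :
    MemLp (deriv (zeroExtend f)) 2 areaMeasure ↔ dirichletIntegral f < ∞ := by
  rw [← eLpNorm_sq]
  simp [MemLp, (measurable_deriv (zeroExtend f)).aestronglyMeasurable]

/-- The Dirichlet space as a subspace of the vector space of all functions on the disc. -/
def dirichletSubmodule : Submodule ℂ (𝔻 → ℂ) where
  carrier := {f | MemDirichlet f}
  zero_mem' := by
    refine ⟨?_, ?_⟩
    · rw [IsHolomorphic, zeroExtend_zero]
      exact differentiableOn_const 0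
    · rw [dirichletIntegral, zeroExtend_zero]
      simp
  add_mem' := by
    rintro f g ⟨hf, hf'⟩ ⟨hg, hg'⟩
    refine ⟨?_, ?_⟩
    · rw [IsHolomorphic, zeroExtend_add]
      exact hf.add hg
    · rw [← memLp_iff] at hf' hg' ⊢
      exact (memLp_congr_ae (deriv_add_ae hf hg)).2 (hf'.add hg')
  smul_mem' := by
    rintro c f ⟨hf, hf'⟩
    refine ⟨?_, ?_⟩
    · rw [IsHolomorphic, zeroExtend_smul]
      exact hf.const_smul c
    · rw [← memLp_iff] at hf' ⊢
      exact (memLp_congr_ae (deriv_smul_ae c hf)).2 (hf'.const_smul c)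

/-- The Dirichlet space. It is a type of its own, so that it carries only the topology of the norm
below and not the topology of pointwise convergence. -/
def DirichletSpace : Type := dirichletSubmodule

namespace DirichletSpace

instance : AddCommGroup DirichletSpace := inferInstanceAs (AddCommGroup dirichletSubmodule)

instance : Module ℂ DirichletSpace := inferInstanceAs (Module ℂ dirichletSubmodule)

instance : CoeFun DirichletSpace (fun _ => 𝔻 → ℂ) := ⟨Subtype.val⟩

/-- The norm `‖f‖ = (|f(0)|² + ∫_𝔻 |f'|² dA)^{1/2}`. -/
instance : Norm DirichletSpace :=
  ⟨fun f => Real.sqrt (‖f 0‖ ^ 2 + (dirichletIntegral f).toReal)⟩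

theorem memDirichlet (f : DirichletSpace) : MemDirichlet f := f.2

theorem memLp_deriv (f : DirichletSpace) : MemLp (deriv (zeroExtend f)) 2 areaMeasure :=
  (memLp_iff f).2 f.memDirichlet.2

/-- The map `f ↦ (f(0), f')`. -/
def toProd : DirichletSpace →ₗ[ℂ] WithLp 2 (ℂ × Lp ℂ 2 areaMeasure) where
  toFun f := WithLp.toLp 2 (f 0, f.memLp_deriv.toLp _)
  map_add' f g := by
    rw [← WithLp.toLp_add, Prod.mk_add_mk, ← MemLp.toLp_add]
    congr 2
    exact MemLp.toLp_congr _ _ (deriv_add_ae f.memDirichlet.1 g.memDirichlet.1)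
  map_smul' c f := by
    rw [RingHom.id_apply, ← WithLp.toLp_smul, Prod.smul_mk, ← MemLp.toLp_const_smul]
    congr 2
    exact MemLp.toLp_congr _ _ (deriv_smul_ae c f.memDirichlet.1)

theorem norm_toProd (f : DirichletSpace) : ‖toProd f‖ = ‖f‖ := by
  rw [WithLp.prod_norm_eq_of_L2]
  change Real.sqrt (‖f 0‖ ^ 2 + ‖f.memLp_deriv.toLp _‖ ^ 2) = _
  rw [Lp.norm_toLp, ← ENNReal.toReal_pow, eLpNorm_sq]
  rfl

theorem toProd_injective : Function.Injective toProd := by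
  rw [injective_iff_map_eq_zero]
  intro f hf
  have h0 : f 0 = 0 := congrArg WithLp.fst hf
  have h1 : f.memLp_deriv.toLp _ = 0 := congrArg WithLp.snd hf
  have hπ : (ENNReal.ofReal Real.pi)⁻¹ ≠ 0 := ENNReal.inv_ne_zero.2 ENNReal.ofReal_ne_top
  have h2 : deriv (zeroExtend f) =ᵐ[volume.restrict (ball 0 1)] 0 := by
    have := (MemLp.toLp_eq_toLp_iff f.memLp_deriv MemLp.zero).1 (h1.trans (MemLp.toLp_zero _).symm)
    exact (Measure.ae_ennreal_smul_measure_iff hπ).1 this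
  have hd : DifferentiableOn ℂ (zeroExtend f) (ball 0 1) := f.memDirichlet.1
  have h3 : Set.EqOn (deriv (zeroExtend f)) 0 (ball 0 1) :=
    Measure.eqOn_open_of_ae_eq h2 isOpen_ball
      (hd.deriv isOpen_ball).continuousOn continuousOn_const
  refine Subtype.ext (funext fun z => ?_)
  have h4 := isOpen_ball.is_const_of_deriv_eq_zero (convex_ball (0 : ℂ) 1).isPreconnected hd h3
    (x := (z : ℂ)) (y := ((0 : 𝔻) : ℂ)) (mem_ball_zero_iff.2 z.norm_lt_one)
    (mem_ball_zero_iff.2 (Complex.UnitDisc.norm_lt_one 0))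
  rw [zeroExtend_coe, zeroExtend_coe] at h4
  exact h4.trans h0

theorem normedSpaceCore : NormedSpace.Core ℂ DirichletSpace where
  norm_nonneg f := Real.sqrt_nonneg _
  norm_smul c f := by rw [← norm_toProd, ← norm_toProd, map_smul, norm_smul]
  norm_triangle f g := by
    rw [← norm_toProd, ← norm_toProd, ← norm_toProd, map_add]
    exact norm_add_le _ _
  norm_eq_zero_iff f := by
    rw [← norm_toProd, norm_eq_zero, map_eq_zero_iff _ toProd_injective]

instance : NormedAddCommGroup DirichletSpace := NormedAddCommGroup.ofCore normedSpaceCore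

instance : NormedSpace ℂ DirichletSpace := NormedSpace.ofCore normedSpaceCore

end DirichletSpace

/-- The linear map `T` on the Dirichlet space is the composition operator `f ↦ f ∘ φ`. Since `T` is
determined by `φ`, the existence of such a `T` says that `f ∘ φ` lies in the Dirichlet space for
every `f` in it. -/
def IsCompositionOperator (φ : 𝔻 → 𝔻) (T : DirichletSpace →ₗ[ℂ] DirichletSpace) : Prop :=
  ∀ (f : DirichletSpace) (z : 𝔻), T f z = f (φ z)

/-- The composition operator with symbol `φ` is defined and bounded on the Dirichlet space. -/
def CompositionBounded (φ : 𝔻 → 𝔻) : Prop :=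
  ∃ T : DirichletSpace →L[ℂ] DirichletSpace, IsCompositionOperator φ T

/-- The composition operator with symbol `φ` is defined, bounded and compact on the
Dirichlet space. -/
def CompositionCompact (φ : 𝔻 → 𝔻) : Prop :=
  ∃ T : DirichletSpace →L[ℂ] DirichletSpace, IsCompositionOperator φ T ∧ IsCompactOperator T

end DirichletComposition

end

/-!
Expand `f' = ∑ bₙ wⁿ` on the disc and let `dμ = |φ'|² dA`, so that
`𝒟(f ∘ φ) = ∫ |∑ bₙ φⁿ|² dμ` and `𝒟(φⁿ⁺¹) = (n + 1)² ∫ |φ|²ⁿ dμ`. If `𝒟(φⁿ⁺¹) ≤ M` for all `n`, the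
moments satisfy `∫ |φ|ᵏ dμ ≤ 4M / (k + 1)²`, and the quadratic form with matrix `(n + m + 1)⁻²` is
bounded by `4 ∑ |bₙ|² / (n + 1) ≤ 4 𝒟(f)`, the last step being Parseval on circles. Hence
`𝒟(f ∘ φ) ≤ 16 M 𝒟(f)`. When `b₀, …, b_{N-1}` vanish, only the moments with `n ≥ N` enter, so if
`𝒟(φⁿ) → 0` then `C_φ` is arbitrarily small in norm on subspaces of finite codimension, which makes
it compact.
-/

noncomputable section

namespace DirichletComposition

open MeasureTheory Metric Filter Topology Set
open scoped ENNReal NNReal Real Complex.UnitDisc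

theorem enorm_natCast_add_one (n : ℕ) : ‖(n : ℂ) + 1‖ₑ = n + 1 := by
  rw [← Nat.cast_succ, ← ofReal_norm, Complex.norm_natCast, ENNReal.ofReal_natCast, Nat.cast_succ]

theorem exists_lt_top_forall_le_of_tendsto {u : ℕ → ℝ≥0∞} {a : ℝ≥0∞} (hu : ∀ n, u n ≠ ∞)
    (ha : a ≠ ∞) (h : Tendsto u atTop (𝓝 a)) : ∃ M < ∞, ∀ n, u n ≤ M := by
  lift u to ℕ → ℝ≥0 using hu
  lift a to ℝ≥0 using ha
  obtain ⟨M, hM⟩ := (ENNReal.tendsto_coe.1 h).bddAbove_range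
  exact ⟨M, ENNReal.coe_lt_top, fun n => ENNReal.coe_le_coe.2 (hM ⟨n, rfl⟩)⟩

section TaylorCoefficients

variable {g : ℂ → ℂ} {c z : ℂ} {r R : ℝ}

/-- The `n`-th coefficient of the Taylor series of `g` at `c`. -/
def taylorCoeff (g : ℂ → ℂ) (c : ℂ) (n : ℕ) : ℂ :=
  (n.factorial : ℂ)⁻¹ * iteratedDeriv n g c

theorem hasSum_taylorCoeff (hg : DifferentiableOn ℂ g (ball c R)) (hz : z ∈ ball c R) :
    HasSum (fun n => taylorCoeff g c n * (z - c) ^ n) (g z) := by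
  refine (Complex.hasSum_taylorSeries_on_ball hg hz).congr_fun fun n => ?_
  rw [taylorCoeff, smul_eq_mul, smul_eq_mul]
  ring

theorem enorm_le_tsum_taylorCoeff (hg : DifferentiableOn ℂ g (ball c R)) (hz : z ∈ ball c R) :
    ‖g z‖ₑ ≤ ∑' n, ‖taylorCoeff g c n‖ₑ * ‖z - c‖ₑ ^ n := by
  rw [← (hasSum_taylorCoeff hg hz).tsum_eq]
  exact (enorm_tsum_le_tsum_enorm).trans_eq (by simp only [enorm_mul, enorm_pow])

theorem taylorCoeff_deriv (g : ℂ → ℂ) (c : ℂ) (n : ℕ) :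
    taylorCoeff (deriv g) c n = (n + 1) * taylorCoeff g c (n + 1) := by
  have hn : (n : ℂ) + 1 ≠ 0 := Nat.cast_add_one_ne_zero n
  simp only [taylorCoeff, iteratedDeriv_succ', Nat.factorial_succ, Nat.cast_mul, Nat.cast_succ]
  field_simp

theorem intervalIntegral_exp_mul_circleMap (hr : 0 < r) (hg : DiffContOnCl ℂ g (ball c r)) (n : ℕ) :
    ∫ θ in 0..2 * π, Complex.exp (-(n * θ * Complex.I)) * g (circleMap c r θ) =
      2 * π * (taylorCoeff g c n * r ^ n) := by
  have hr' : (r : ℂ) ≠ 0 := Complex.ofReal_ne_zero.2 hr.ne'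
  have hcauchy := hg.circleIntegral_one_div_sub_center_pow_smul hr n
  have hintegrand : ∀ θ : ℝ, deriv (circleMap c r) θ •
      (1 / (circleMap c r θ - c) ^ (n + 1)) • g (circleMap c r θ) =
        Complex.I / r ^ n * (Complex.exp (-(n * θ * Complex.I)) * g (circleMap c r θ)) := by
    intro θ
    have hexp := Complex.exp_ne_zero (θ * Complex.I)
    rw [deriv_circleMap, circleMap_sub_center, circleMap_zero, Complex.exp_neg, mul_assoc (n : ℂ),
      Complex.exp_nat_mul, smul_eq_mul, smul_eq_mul, mul_pow]
    field_simp
    ring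
  simp only [circleIntegral, hintegrand, intervalIntegral.integral_const_mul] at hcauchy
  have hI := Complex.I_ne_zero
  rw [taylorCoeff, ← mul_right_inj' (div_ne_zero hI (pow_ne_zero n hr')), hcauchy, smul_eq_mul]
  field_simp

theorem fourierCoeffOn_circleMap (hr : 0 < r) (hg : DiffContOnCl ℂ g (ball c r)) (n : ℕ) :
    fourierCoeffOn (neg_lt_self Real.pi_pos) (fun θ => g (circleMap c r θ)) n =
      taylorCoeff g c n * r ^ n := by
  set F : ℝ → ℂ := fun θ => Complex.exp (-(n * θ * Complex.I)) * g (circleMap c r θ) with hF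
  have hperiodic : Function.Periodic F (2 * π) := fun θ => by
    have : -(n * ((θ + 2 * π : ℝ) : ℂ) * Complex.I) =
        -(n * θ * Complex.I) + (-n : ℤ) * (2 * π * Complex.I) := by push_cast; ring
    simp only [hF, this, Complex.exp_add, Complex.exp_int_mul_two_pi_mul_I, mul_one,
      periodic_circleMap c r θ]
  have hshift : ∫ θ in -π..π, F θ = ∫ θ in 0..2 * π, F θ := by
    have := hperiodic.intervalIntegral_add_eq (-π) 0
    rwa [zero_add, neg_add_eq_sub, two_mul, add_sub_cancel_right, ← two_mul] at this
  have hfourier : ∀ θ : ℝ, fourier (-n) (θ : AddCircle (π - -π)) • g (circleMap c r θ) = F θ := by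
    intro θ
    rw [fourier_coe_apply, smul_eq_mul, hF]
    congr 2
    push_cast
    field_simp
    ring
  rw [fourierCoeffOn_eq_integral]
  simp only [hfourier]
  rw [hshift, intervalIntegral_exp_mul_circleMap hr hg, Complex.real_smul]
  push_cast
  field_simp
  ring

theorem tsum_taylorCoeff_le_lintegral_circle (hr : 0 < r) (hg : DiffContOnCl ℂ g (ball c r)) :
    ENNReal.ofReal (2 * π) * ∑' n, ‖taylorCoeff g c n‖ₑ ^ 2 * ENNReal.ofReal r ^ (2 * n) ≤
      ∫⁻ θ in Ioo (-π) π, ‖g (circleMap c r θ)‖ₑ ^ 2 := by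
  have hπ : -π < π := neg_lt_self Real.pi_pos
  have hcont : Continuous fun θ => g (circleMap c r θ) := by
    refine hg.continuousOn_ball.comp_continuous (continuous_circleMap c r) fun θ => ?_
    exact sphere_subset_closedBall (circleMap_mem_sphere c hr.le θ)
  have hint : IntegrableOn (fun θ => ‖g (circleMap c r θ)‖ ^ 2) (Ioc (-π) π) :=
    (hcont.norm.pow 2).integrableOn_Ioc
  have hparseval := hasSum_sq_fourierCoeffOn hπ
    ((memLp_two_iff_integrable_sq_norm hcont.aestronglyMeasurable).2 hint)
  rw [intervalIntegral.integral_of_le hπ.le, sub_neg_eq_add, ← two_mul, smul_eq_mul] at hparseval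
  have hcoeff : ∀ n : ℕ, ‖taylorCoeff g c n‖ₑ ^ 2 * ENNReal.ofReal r ^ (2 * n) =
      ENNReal.ofReal (‖fourierCoeffOn hπ (fun θ => g (circleMap c r θ)) n‖ ^ 2) := fun n => by
    rw [fourierCoeffOn_circleMap hr hg, ENNReal.ofReal_pow (norm_nonneg _), ofReal_norm, enorm_mul,
      enorm_pow, mul_pow, ← pow_mul', ← ofReal_norm (r : ℂ), Complex.norm_of_nonneg hr.le]
  calc ENNReal.ofReal (2 * π) * ∑' n, ‖taylorCoeff g c n‖ₑ ^ 2 * ENNReal.ofReal r ^ (2 * n)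
      ≤ ENNReal.ofReal (2 * π) *
          ∑' k, ENNReal.ofReal (‖fourierCoeffOn hπ (fun θ => g (circleMap c r θ)) k‖ ^ 2) := by
        simp only [hcoeff]
        gcongr
        exact ENNReal.tsum_comp_le_tsum_of_injective Nat.cast_injective _
    _ = ENNReal.ofReal (∫ θ in Ioc (-π) π, ‖g (circleMap c r θ)‖ ^ 2) := by
        rw [← ENNReal.ofReal_tsum_of_nonneg (fun _ => by positivity) hparseval.summable,
          hparseval.tsum_eq, ← ENNReal.ofReal_mul (by positivity),
          mul_inv_cancel_left₀ (by positivity)]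
    _ = ∫⁻ θ in Ioo (-π) π, ‖g (circleMap c r θ)‖ₑ ^ 2 := by
        rw [ofReal_integral_eq_lintegral_ofReal hint (Eventually.of_forall fun _ => by positivity),
          restrict_Ioo_eq_restrict_Ioc]
        simp only [ENNReal.ofReal_pow (norm_nonneg _), ofReal_norm]

theorem lintegral_ball_eq_polar {F : ℂ → ℝ≥0∞} (hF : Measurable F) (c : ℂ) (R : ℝ) :
    ∫⁻ z in ball c R, F z =
      ∫⁻ r in Ioo 0 R, ENNReal.ofReal r * ∫⁻ θ in Ioo (-π) π, F (circleMap c r θ) := by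
  set G : ℂ → ℝ≥0∞ := (ball c R).indicator F with hG
  have hGm : Measurable G := hF.indicator measurableSet_ball
  have hsymm : ∀ p : ℝ × ℝ, c + Complex.polarCoord.symm p = circleMap c p.1 p.2 := fun p => by
    rw [Complex.polarCoord_symm_apply, circleMap, Complex.exp_mul_I]
    push_cast; rfl
  have hcm : Measurable fun p : ℝ × ℝ => circleMap c p.1 p.2 :=
    Continuous.measurable (by unfold circleMap; fun_prop)
  have hGcircle : ∀ r ∈ Ioi (0 : ℝ), ENNReal.ofReal r * ∫⁻ θ in Ioo (-π) π, G (circleMap c r θ) =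
      (Iio R).indicator
        (fun r => ENNReal.ofReal r * ∫⁻ θ in Ioo (-π) π, F (circleMap c r θ)) r := by
    intro r hr
    have hmem : ∀ θ, circleMap c r θ ∈ ball c R ↔ r ∈ Iio R := fun θ => by
      simp [circleMap, abs_of_pos (mem_Ioi.1 hr)]
    by_cases hrR : r ∈ Iio R <;> simp [hG, indicator, hmem, hrR]
  calc ∫⁻ z in ball c R, F z
      = ∫⁻ z, G (c + z) := by
        rw [lintegral_add_left_eq_self G c, hG, lintegral_indicator measurableSet_ball]
    _ = ∫⁻ p in polarCoord.target, ENNReal.ofReal p.1 * G (circleMap c p.1 p.2) := by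
        rw [← Complex.lintegral_comp_polarCoord_symm fun z => G (c + z)]
        simp only [hsymm, smul_eq_mul]
    _ = ∫⁻ r in Ioi 0, ENNReal.ofReal r * ∫⁻ θ in Ioo (-π) π, G (circleMap c r θ) := by
        rw [polarCoord_target, Measure.volume_eq_prod, ← Measure.prod_restrict, lintegral_prod]
        · simp only [lintegral_const_mul' _ _ ENNReal.ofReal_ne_top]
        · exact ((measurable_fst.ennreal_ofReal).mul (hGm.comp hcm)).aemeasurable
    _ = _ := by
        rw [setLIntegral_congr_fun measurableSet_Ioi hGcircle,
          setLIntegral_indicator measurableSet_Iio, inter_comm, Ioi_inter_Iio]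

theorem lintegral_Ioo_ofReal_pow (hR : 0 ≤ R) (n : ℕ) :
    ∫⁻ r in Ioo 0 R, ENNReal.ofReal r ^ n = ENNReal.ofReal R ^ (n + 1) / (n + 1) := by
  have hint : IntegrableOn (fun r : ℝ => r ^ n) (Ioc 0 R) := (continuous_pow n).integrableOn_Ioc
  have hnonneg : ∀ r ∈ Ioc 0 R, ENNReal.ofReal r ^ n = ENNReal.ofReal (r ^ n) := fun r hr =>
    (ENNReal.ofReal_pow hr.1.le n).symm
  rw [restrict_Ioo_eq_restrict_Ioc, setLIntegral_congr_fun measurableSet_Ioc hnonneg,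
    ← ofReal_integral_eq_lintegral_ofReal hint, ← intervalIntegral.integral_of_le hR, integral_pow,
    zero_pow n.succ_ne_zero, sub_zero, ENNReal.ofReal_div_of_pos (by positivity),
    ENNReal.ofReal_pow hR, ENNReal.ofReal_add n.cast_nonneg zero_le_one, ENNReal.ofReal_natCast,
    ENNReal.ofReal_one]
  filter_upwards [ae_restrict_mem measurableSet_Ioc] with r hr using pow_nonneg hr.1.le n

theorem tsum_taylorCoeff_le_lintegral_ball (hR : 0 ≤ R) (hgm : Measurable g)
    (hg : DifferentiableOn ℂ g (ball c R)) :
    ENNReal.ofReal π *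
        ∑' n, ‖taylorCoeff g c n‖ₑ ^ 2 * ENNReal.ofReal R ^ (2 * (n + 1)) / (n + 1) ≤
      ∫⁻ z in ball c R, ‖g z‖ₑ ^ 2 := by
  have hradial : ∀ n : ℕ,
      ENNReal.ofReal (2 * π) * ∫⁻ r in Ioo 0 R, ENNReal.ofReal r ^ (2 * n + 1) =
        ENNReal.ofReal π * (ENNReal.ofReal R ^ (2 * (n + 1)) / (n + 1)) := fun n => by
    have htwo : ((2 * n + 1 : ℕ) : ℝ≥0∞) + 1 = 2 * (n + 1) := by push_cast; ring
    rw [lintegral_Ioo_ofReal_pow hR, htwo, ENNReal.ofReal_mul two_pos.le, ENNReal.ofReal_ofNat,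
      mul_comm 2, mul_assoc, ← mul_div_assoc,
      ENNReal.mul_div_mul_left _ _ two_ne_zero ENNReal.ofNat_ne_top]
    ring_nf
  have hdisc : ∀ r ∈ Ioo 0 R, DiffContOnCl ℂ g (ball c r) := fun r hr =>
    (hg.mono (closedBall_subset_ball hr.2)).diffContOnCl_ball subset_rfl
  rw [lintegral_ball_eq_polar (hgm.enorm.pow_const 2)]
  calc ENNReal.ofReal π *
          ∑' n, ‖taylorCoeff g c n‖ₑ ^ 2 * ENNReal.ofReal R ^ (2 * (n + 1)) / (n + 1)
      = ∑' n, ‖taylorCoeff g c n‖ₑ ^ 2 *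
          (ENNReal.ofReal (2 * π) * ∫⁻ r in Ioo 0 R, ENNReal.ofReal r ^ (2 * n + 1)) := by
        simp only [hradial, ← ENNReal.tsum_mul_left, mul_div_assoc]
        refine tsum_congr fun n => ?_
        ring
    _ = ∫⁻ r in Ioo 0 R, ENNReal.ofReal r *
          (ENNReal.ofReal (2 * π) *
            ∑' n, ‖taylorCoeff g c n‖ₑ ^ 2 * ENNReal.ofReal r ^ (2 * n)) := by
        simp only [← ENNReal.tsum_mul_left]
        rw [lintegral_tsum fun n => by fun_prop]
        refine tsum_congr fun n => ?_
        rw [← lintegral_const_mul' _ _ ENNReal.ofReal_ne_top, ← lintegral_const_mul' _ _ (by simp)]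
        refine lintegral_congr fun r => ?_
        ring
    _ ≤ _ := setLIntegral_mono' measurableSet_Ioo fun r hr => by
        gcongr
        exact tsum_taylorCoeff_le_lintegral_circle hr.1 (hdisc r hr)

end TaylorCoefficients

section Moments

theorem mul_le_sq_add_sq (a b : ℝ≥0∞) : a * b ≤ a ^ 2 + b ^ 2 := by
  rcases le_total a b with h | h
  · exact (mul_le_mul_left h b).trans (sq b ▸ le_add_self)
  · exact (mul_le_mul_right h a).trans (sq a ▸ le_self_add)

theorem tsum_inv_add_sq_le (n : ℕ) :
    ∑' m : ℕ, (((n + m : ℕ) + 1 : ℝ≥0∞) ^ 2)⁻¹ ≤ 2 / (n + 1) := by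
  refine ENNReal.tsum_le_of_sum_range_le fun k => ?_
  have hofReal : ∀ m : ℕ, (((n + m : ℕ) + 1 : ℝ≥0∞) ^ 2)⁻¹ =
      ENNReal.ofReal (((n + 1 + m : ℕ) : ℝ) ^ 2)⁻¹ := fun m => by
    rw [ENNReal.ofReal_inv_of_pos (by positivity), ENNReal.ofReal_pow (by positivity),
      ENNReal.ofReal_natCast, add_right_comm, Nat.cast_succ]
  have hIoo : Finset.Ico (n + 1) (n + 1 + k) = Finset.Ioo n (n + 1 + k) :=
    Finset.Ico_add_one_left_eq_Ioo n _
  calc ∑ m ∈ Finset.range k, (((n + m : ℕ) + 1 : ℝ≥0∞) ^ 2)⁻¹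
      = ENNReal.ofReal (∑ i ∈ Finset.Ioo n (n + 1 + k), ((i : ℝ) ^ 2)⁻¹) := by
        rw [← hIoo, Finset.sum_Ico_eq_sum_range, add_tsub_cancel_left,
          ENNReal.ofReal_sum_of_nonneg fun _ _ => by positivity]
        exact Finset.sum_congr rfl fun m _ => hofReal m
    _ ≤ ENNReal.ofReal (2 / (n + 1)) := ENNReal.ofReal_le_ofReal (sum_Ioo_inv_sq_le n _)
    _ = 2 / (n + 1) := by
        rw [ENNReal.ofReal_div_of_pos (by positivity), ENNReal.ofReal_ofNat,
          ENNReal.ofReal_add n.cast_nonneg zero_le_one, ENNReal.ofReal_natCast, ENNReal.ofReal_one]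

theorem tsum_tsum_mul_div_sq_le (x : ℕ → ℝ≥0∞) :
    ∑' n, ∑' m, x n * x m * (((n + m : ℕ) + 1 : ℝ≥0∞) ^ 2)⁻¹ ≤ 4 * ∑' n, x n ^ 2 / (n + 1) := by
  have hrow : ∑' n, ∑' m, x n ^ 2 * (((n + m : ℕ) + 1 : ℝ≥0∞) ^ 2)⁻¹ ≤
      2 * ∑' n, x n ^ 2 / (n + 1) := by
    rw [← ENNReal.tsum_mul_left]
    refine ENNReal.tsum_le_tsum fun n => ?_
    calc _ ≤ x n ^ 2 * (2 / (n + 1)) := by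
          rw [ENNReal.tsum_mul_left]
          gcongr
          exact tsum_inv_add_sq_le n
      _ = 2 * (x n ^ 2 / (n + 1)) := by simp only [div_eq_mul_inv, mul_left_comm]
  have hcol : ∑' n, ∑' m, x m ^ 2 * (((n + m : ℕ) + 1 : ℝ≥0∞) ^ 2)⁻¹ ≤
      2 * ∑' n, x n ^ 2 / (n + 1) := by
    rw [ENNReal.tsum_comm]
    simpa only [add_comm] using hrow
  calc _ ≤ ∑' n, ∑' m, (x n ^ 2 * (((n + m : ℕ) + 1 : ℝ≥0∞) ^ 2)⁻¹ +
          x m ^ 2 * (((n + m : ℕ) + 1 : ℝ≥0∞) ^ 2)⁻¹) := by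
        gcongr with n m
        rw [← add_mul]
        gcongr
        exact mul_le_sq_add_sq _ _
    _ ≤ 2 * ∑' n, x n ^ 2 / (n + 1) + 2 * ∑' n, x n ^ 2 / (n + 1) := by
        simp only [ENNReal.tsum_add]
        exact add_le_add hrow hcol
    _ = _ := by ring

variable {α : Type*} [MeasurableSpace α] {ν : Measure α} {ρ : α → ℝ≥0∞} {M : ℝ≥0∞} {N : ℕ}

theorem sq_mul_lintegral_pow_le_of_even (hρ : ∀ᵐ z ∂ν, ρ z ≤ 1)
    (h : ∀ n ≥ N, ((n : ℝ≥0∞) + 1) ^ 2 * ∫⁻ z, ρ z ^ (2 * n) ∂ν ≤ M) {k : ℕ} (hk : 2 * N ≤ k) :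
    ((k : ℝ≥0∞) + 1) ^ 2 * ∫⁻ z, ρ z ^ k ∂ν ≤ 4 * M := by
  have hcast : ((k : ℝ≥0∞) + 1) ≤ 2 * ((k / 2 : ℕ) + 1) := by
    exact_mod_cast (by omega : k + 1 ≤ 2 * (k / 2 + 1))
  calc ((k : ℝ≥0∞) + 1) ^ 2 * ∫⁻ z, ρ z ^ k ∂ν
      ≤ (2 * ((k / 2 : ℕ) + 1)) ^ 2 * ∫⁻ z, ρ z ^ (2 * (k / 2)) ∂ν := by
        gcongr ?_ ^ 2 * ?_
        refine lintegral_mono_ae (hρ.mono fun z hz => ?_)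
        exact pow_le_pow_right_of_le_one' hz (Nat.mul_div_le k 2)
    _ = 4 * (((k / 2 : ℕ) + 1) ^ 2 * ∫⁻ z, ρ z ^ (2 * (k / 2)) ∂ν) := by ring
    _ ≤ 4 * M := by
        gcongr
        exact h _ (by omega)

theorem lintegral_sq_tsum_mul_pow_le (hρm : Measurable ρ) (hρ : ∀ᵐ z ∂ν, ρ z ≤ 1)
    (h : ∀ n ≥ N, ((n : ℝ≥0∞) + 1) ^ 2 * ∫⁻ z, ρ z ^ (2 * n) ∂ν ≤ M)
    {x : ℕ → ℝ≥0∞} (hx : ∀ n < N, x n = 0) :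
    ∫⁻ z, (∑' n, x n * ρ z ^ n) ^ 2 ∂ν ≤ 16 * M * ∑' n, x n ^ 2 / (n + 1) := by
  have hterm : ∀ n m, x n * x m * ∫⁻ z, ρ z ^ (n + m) ∂ν ≤
      4 * M * (x n * x m * (((n + m : ℕ) + 1 : ℝ≥0∞) ^ 2)⁻¹) := fun n m => by
    rcases lt_or_ge n N with hn | hn
    · simp [hx n hn]
    rcases lt_or_ge m N with hm | hm
    · simp [hx m hm]
    have hmoment := sq_mul_lintegral_pow_le_of_even hρ h (k := n + m) (by omega)
    calc x n * x m * ∫⁻ z, ρ z ^ (n + m) ∂ν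
        ≤ x n * x m * (4 * M / ((n + m : ℕ) + 1) ^ 2) := by
          gcongr
          rwa [ENNReal.le_div_iff_mul_le (by simp) (by simp), mul_comm]
      _ = _ := by rw [div_eq_mul_inv]; ring
  calc ∫⁻ z, (∑' n, x n * ρ z ^ n) ^ 2 ∂ν
      = ∫⁻ z, ∑' n, ∑' m, x n * x m * ρ z ^ (n + m) ∂ν := by
        refine lintegral_congr fun z => ?_
        simp only [sq, ← ENNReal.tsum_mul_right, ← ENNReal.tsum_mul_left]
        exact tsum_congr fun n => tsum_congr fun m => by ring
    _ = ∑' n, ∑' m, x n * x m * ∫⁻ z, ρ z ^ (n + m) ∂ν := by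
        rw [lintegral_tsum fun n => by fun_prop]
        refine tsum_congr fun n => ?_
        rw [lintegral_tsum fun m => by fun_prop]
        exact tsum_congr fun m => lintegral_const_mul _ (by fun_prop)
    _ ≤ 4 * M * ∑' n, ∑' m, x n * x m * (((n + m : ℕ) + 1 : ℝ≥0∞) ^ 2)⁻¹ := by
        simp only [← ENNReal.tsum_mul_left (a := 4 * M)]
        exact ENNReal.tsum_le_tsum fun n => ENNReal.tsum_le_tsum fun m => hterm n m
    _ ≤ 4 * M * (4 * ∑' n, x n ^ 2 / (n + 1)) := by
        gcongr
        exact tsum_tsum_mul_div_sq_le x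
    _ = _ := by ring

end Moments

section Compactness

variable {𝕜 E F : Type*} [NontriviallyNormedField 𝕜] [SeminormedAddCommGroup E] [NormedSpace 𝕜 E]
  [NormedAddCommGroup F] [NormedSpace 𝕜 F] {T : E →L[𝕜] F} {V : Submodule 𝕜 E} {ε : ℝ}

theorem norm_apply_le_add_norm_mk (hε : 0 ≤ ε) (hT : ∀ x ∈ V, ‖T x‖ ≤ ε * ‖x‖) (x : E) :
    ‖T x‖ ≤ ε * ‖x‖ + (ε + ‖T‖) * ‖(Submodule.Quotient.mk x : E ⧸ V)‖ := by
  refine le_of_forall_pos_le_add fun δ hδ => ?_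
  set C := ε + ‖T‖
  have hC : 0 ≤ C := by positivity
  obtain ⟨y, hyx, hy⟩ := Submodule.Quotient.norm_mk_lt (Submodule.Quotient.mk x : E ⧸ V)
    (show 0 < δ / (C + 1) by positivity)
  have hmem : x - y ∈ V := (Submodule.Quotient.eq V).1 hyx.symm
  calc ‖T x‖ = ‖T (x - y) + T y‖ := by rw [← map_add, sub_add_cancel]
    _ ≤ ε * ‖x - y‖ + ‖T‖ * ‖y‖ := (norm_add_le _ _).trans (add_le_add (hT _ hmem) (T.le_opNorm y))
    _ ≤ ε * (‖x‖ + ‖y‖) + ‖T‖ * ‖y‖ := by gcongr; exact norm_sub_le x y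
    _ = ε * ‖x‖ + C * ‖y‖ := by ring
    _ ≤ ε * ‖x‖ + C * (‖(Submodule.Quotient.mk x : E ⧸ V)‖ + δ / (C + 1)) := by gcongr
    _ = ε * ‖x‖ + C * ‖(Submodule.Quotient.mk x : E ⧸ V)‖ + C / (C + 1) * δ := by ring
    _ ≤ ε * ‖x‖ + C * ‖(Submodule.Quotient.mk x : E ⧸ V)‖ + δ := by
      gcongr
      exact mul_le_of_le_one_left hδ.le (div_le_one_of_le₀ (by linarith) (by linarith))

theorem norm_apply_le_of_mem_topologicalClosure (hT : ∀ x ∈ V, ‖T x‖ ≤ ε * ‖x‖) {x : E}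
    (hx : x ∈ V.topologicalClosure) : ‖T x‖ ≤ ε * ‖x‖ :=
  closure_minimal (s := (V : Set E)) (t := {x | ‖T x‖ ≤ ε * ‖x‖}) hT
    (isClosed_le (by fun_prop) (by fun_prop)) hx

theorem totallyBounded_mk_image_closedBall [LocallyCompactSpace 𝕜] [IsClosed (V : Set E)]
    [V.CoFG] (r : ℝ) :
    TotallyBounded ((Submodule.Quotient.mk : E → E ⧸ V) '' closedBall 0 r) := by
  have : ProperSpace (E ⧸ V) := FiniteDimensional.proper 𝕜 (E ⧸ V)
  refine (isCompact_closedBall (0 : E ⧸ V) r).totallyBounded.subset ?_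
  rintro _ ⟨x, hx, rfl⟩
  rw [mem_closedBall_zero_iff] at hx ⊢
  exact (Submodule.Quotient.norm_mk_le V x).trans hx

theorem isCompactOperator_of_forall_exists_coFG [LocallyCompactSpace 𝕜] [CompleteSpace F]
    (h : ∀ ε > 0, ∃ V : Submodule 𝕜 E, V.CoFG ∧ ∀ x ∈ V, ‖T x‖ ≤ ε * ‖x‖) :
    IsCompactOperator T := by
  rw [← ContinuousLinearMap.coe_coe,
    isCompactOperator_iff_isCompact_closure_image_closedBall (T : E →ₗ[𝕜] F) one_pos]
  suffices TotallyBounded (T '' closedBall 0 1) from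
    isCompact_iff_totallyBounded_isComplete.2 ⟨this.closure, isClosed_closure.isComplete⟩
  refine Metric.totallyBounded_iff.2 fun δ hδ => ?_
  obtain ⟨V, hV, hT⟩ := h (δ / 4) (by positivity)
  have : IsClosed (V.topologicalClosure : Set E) := V.isClosed_topologicalClosure
  set η := δ / 2 / (δ / 4 + ‖T‖) with hη
  obtain ⟨s, hs, hsfin, hcover⟩ := Set.exists_subset_image_finite_and.1
    (finite_approx_of_totallyBounded
      (totallyBounded_mk_image_closedBall (V := V.topologicalClosure) 1) η (by positivity))
  refine ⟨T '' s, hsfin.image T, ?_⟩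
  rintro _ ⟨x, hx, rfl⟩
  obtain ⟨y, hy, hxy⟩ : ∃ y ∈ s,
      dist (Submodule.Quotient.mk x : E ⧸ V.topologicalClosure) (Submodule.Quotient.mk y) < η := by
    simpa only [biUnion_image, mem_iUnion, mem_ball, exists_prop] using
      hcover (mem_image_of_mem _ hx)
  have hxy_le : ‖x - y‖ ≤ 2 := by
    have hx1 := mem_closedBall_zero_iff.1 hx
    have hy1 := mem_closedBall_zero_iff.1 (hs hy)
    linarith [norm_sub_le x y]
  rw [dist_eq_norm, ← Submodule.Quotient.mk_sub] at hxy
  refine mem_biUnion (mem_image_of_mem T hy) ?_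
  rw [mem_ball, dist_eq_norm, ← map_sub]
  calc ‖T (x - y)‖ ≤ δ / 4 * ‖x - y‖ + (δ / 4 + ‖T‖) *
          ‖(Submodule.Quotient.mk (x - y) : E ⧸ V.topologicalClosure)‖ :=
        norm_apply_le_add_norm_mk (by positivity)
          (fun _ => norm_apply_le_of_mem_topologicalClosure hT) _
    _ ≤ δ / 4 * 2 + (δ / 4 + ‖T‖) *
          ‖(Submodule.Quotient.mk (x - y) : E ⧸ V.topologicalClosure)‖ := by gcongr
    _ < δ / 4 * 2 + (δ / 4 + ‖T‖) * η := by gcongr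
    _ = δ := by rw [hη]; field_simp; ring

end Compactness

section Composition

theorem zeroExtend_of_mem (f : 𝔻 → ℂ) {z : ℂ} (hz : ‖z‖ < 1) :
    zeroExtend f z = f (Complex.UnitDisc.mk z hz) := by
  simp [zeroExtend, hz]

theorem IsHolomorphic.measurable {f : 𝔻 → ℂ} (hf : IsHolomorphic f) :
    Measurable (zeroExtend f) := by
  refine measurable_of_restrict_of_restrict_compl measurableSet_ball
    (DifferentiableOn.continuousOn hf).domRestrict.measurable ?_
  convert measurable_const (a := (0 : ℂ)) using 1
  ext z
  have hz : ¬ ‖(z : ℂ)‖ < 1 := fun h => z.2 (mem_ball_zero_iff.2 h)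
  simp [zeroExtend, hz]

theorem IsHolomorphic.differentiableOn_deriv {f : 𝔻 → ℂ} (hf : IsHolomorphic f) :
    DifferentiableOn ℂ (deriv (zeroExtend f)) (ball 0 1) :=
  DifferentiableOn.deriv hf isOpen_ball

theorem lintegral_areaMeasure (F : ℂ → ℝ≥0∞) :
    ∫⁻ z in ball 0 1, F z = ENNReal.ofReal π * ∫⁻ z, F z ∂areaMeasure := by
  rw [areaMeasure, lintegral_smul_measure, smul_eq_mul, ← mul_assoc,
    ENNReal.mul_inv_cancel (by simp [Real.pi_pos]) ENNReal.ofReal_ne_top, one_mul]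

theorem tsum_taylorCoeff_deriv_le_dirichletIntegral {f : 𝔻 → ℂ} (hf : IsHolomorphic f) :
    ∑' n, ‖taylorCoeff (deriv (zeroExtend f)) 0 n‖ₑ ^ 2 / (n + 1) ≤ dirichletIntegral f := by
  have h := tsum_taylorCoeff_le_lintegral_ball zero_le_one (measurable_deriv _)
    hf.differentiableOn_deriv
  simp only [lintegral_areaMeasure, ENNReal.ofReal_one, one_pow, mul_one] at h
  exact (ENNReal.mul_le_mul_iff_right (by simp [Real.pi_pos]) ENNReal.ofReal_ne_top).1 h

variable {φ : 𝔻 → 𝔻} {f : 𝔻 → ℂ}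

theorem zeroExtend_coe_mem_ball (φ : 𝔻 → 𝔻) (z : ℂ) :
    zeroExtend (fun z => (φ z : ℂ)) z ∈ ball (0 : ℂ) 1 := by
  rw [mem_ball_zero_iff]
  by_cases hz : ‖z‖ < 1
  · rw [zeroExtend_of_mem _ hz]
    exact Complex.UnitDisc.norm_lt_one _
  · simp [zeroExtend, hz]

theorem enorm_zeroExtend_coe_le_one (φ : 𝔻 → 𝔻) (z : ℂ) :
    ‖zeroExtend (fun z => (φ z : ℂ)) z‖ₑ ≤ 1 := by
  rw [← ofReal_norm, ENNReal.ofReal_le_one]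
  exact (mem_ball_zero_iff.1 (zeroExtend_coe_mem_ball φ z)).le

theorem zeroExtend_comp_eq (F : ℂ → ℂ) (φ : 𝔻 → 𝔻) {z : ℂ} (hz : z ∈ ball (0 : ℂ) 1) :
    zeroExtend (fun z => F (φ z)) z = F (zeroExtend (fun z => (φ z : ℂ)) z) := by
  have hz' := mem_ball_zero_iff.1 hz
  rw [zeroExtend_of_mem _ hz', zeroExtend_of_mem (fun z => (φ z : ℂ)) hz']

theorem IsHolomorphic.comp {f : 𝔻 → ℂ} (hf : IsHolomorphic f)
    (hφ : IsHolomorphic fun z => (φ z : ℂ)) : IsHolomorphic fun z => f (φ z) :=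
  (DifferentiableOn.comp hf hφ fun z _ => zeroExtend_coe_mem_ball φ z).congr fun z hz => by
    simpa only [zeroExtend_coe, Function.comp_apply] using zeroExtend_comp_eq (zeroExtend f) φ hz

/-- The measure `|φ'|² dA` on the disc: it turns the Dirichlet integral of `f ∘ φ` into the
integral of `|f'|² ∘ φ`. -/
def derivMeasure (φ : 𝔻 → 𝔻) : Measure ℂ :=
  areaMeasure.withDensity fun z => ‖deriv (zeroExtend fun z => (φ z : ℂ)) z‖ₑ ^ 2

theorem dirichletIntegral_comp {F : ℂ → ℂ} (hF : DifferentiableOn ℂ F (ball 0 1))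
    (hφ : IsHolomorphic fun z => (φ z : ℂ)) :
    dirichletIntegral (fun z => F (φ z)) =
      ∫⁻ z, ‖deriv F (zeroExtend (fun z => (φ z : ℂ)) z)‖ₑ ^ 2 ∂derivMeasure φ := by
  set Φ := zeroExtend fun z => (φ z : ℂ)
  have hΦ : ∀ z, Φ z ∈ ball (0 : ℂ) 1 := zeroExtend_coe_mem_ball φ
  have hF' : Measurable fun z => ‖deriv F (Φ z)‖ₑ ^ 2 :=
    ((measurable_deriv F).comp hφ.measurable).enorm.pow_const 2
  rw [derivMeasure, lintegral_withDensity_eq_lintegral_mul _ (by fun_prop) hF']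
  refine lintegral_congr_ae ?_
  filter_upwards [ae_mem_ball] with z hz
  have heq : (zeroExtend fun z => F (φ z)) =ᶠ[𝓝 z] F ∘ Φ := by
    filter_upwards [isOpen_ball.mem_nhds hz] with w hw using zeroExtend_comp_eq F φ hw
  rw [heq.deriv_eq, deriv_comp _ (hF.differentiableAt (isOpen_ball.mem_nhds (hΦ z)))
    (hφ.differentiableAt hz), enorm_mul, mul_pow, mul_comm]
  rfl

theorem dirichletIntegral_pow_succ (hφ : IsHolomorphic fun z => (φ z : ℂ)) (n : ℕ) :
    dirichletIntegral (fun z => (φ z : ℂ) ^ (n + 1)) =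
      (n + 1) ^ 2 * ∫⁻ z, ‖zeroExtend (fun z => (φ z : ℂ)) z‖ₑ ^ (2 * n) ∂derivMeasure φ := by
  rw [dirichletIntegral_comp (F := fun w => w ^ (n + 1)) (differentiableOn_pow _) hφ,
    ← lintegral_const_mul _ (hφ.measurable.enorm.pow_const _)]
  refine lintegral_congr fun z => ?_
  simp [enorm_mul, enorm_natCast_add_one, mul_pow, pow_mul']

theorem dirichletIntegral_pow_succ_le (hφ : IsHolomorphic fun z => (φ z : ℂ)) (n : ℕ) :
    dirichletIntegral (fun z => (φ z : ℂ) ^ (n + 1)) ≤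
      (n + 1) ^ 2 * dirichletIntegral (fun z => (φ z : ℂ)) := by
  have hmass : derivMeasure φ univ = dirichletIntegral fun z => (φ z : ℂ) := by
    simpa using (dirichletIntegral_pow_succ hφ 0).symm
  rw [dirichletIntegral_pow_succ hφ, ← hmass, ← lintegral_one]
  gcongr with z
  exact pow_le_one₀ zero_le (enorm_zeroExtend_coe_le_one φ z)

theorem dirichletIntegral_comp_le {M : ℝ≥0∞} {N : ℕ} (hf : IsHolomorphic f)
    (hφ : IsHolomorphic fun z => (φ z : ℂ))
    (hM : ∀ n ≥ N, dirichletIntegral (fun z => (φ z : ℂ) ^ (n + 1)) ≤ M)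
    (hN : ∀ n < N, taylorCoeff (deriv (zeroExtend f)) 0 n = 0) :
    dirichletIntegral (fun z => f (φ z)) ≤ 16 * M * dirichletIntegral f := by
  set Φ := zeroExtend fun z => (φ z : ℂ)
  simp only [dirichletIntegral_pow_succ hφ] at hM
  calc dirichletIntegral (fun z => f (φ z))
      = ∫⁻ z, ‖deriv (zeroExtend f) (Φ z)‖ₑ ^ 2 ∂derivMeasure φ := by
        rw [← dirichletIntegral_comp hf hφ]
        simp only [zeroExtend_coe]
    _ ≤ ∫⁻ z, (∑' n, ‖taylorCoeff (deriv (zeroExtend f)) 0 n‖ₑ * ‖Φ z‖ₑ ^ n) ^ 2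
          ∂derivMeasure φ := by
        gcongr with z
        simpa only [sub_zero] using
          enorm_le_tsum_taylorCoeff hf.differentiableOn_deriv (zeroExtend_coe_mem_ball φ z)
    _ ≤ 16 * M * ∑' n, ‖taylorCoeff (deriv (zeroExtend f)) 0 n‖ₑ ^ 2 / (n + 1) :=
        lintegral_sq_tsum_mul_pow_le hφ.measurable.enorm
          (ae_of_all _ (enorm_zeroExtend_coe_le_one φ)) hM fun n hn => by simp [hN n hn]
    _ ≤ 16 * M * dirichletIntegral f := by
        gcongr
        exact tsum_taylorCoeff_deriv_le_dirichletIntegral hf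

end Composition

section DirichletNorm

theorem zeroExtend_sub (f g : 𝔻 → ℂ) : zeroExtend (f - g) = zeroExtend f - zeroExtend g := by
  rw [eq_sub_iff_add_eq, ← zeroExtend_add, sub_add_cancel]

theorem deriv_zeroExtend_sub {f g : 𝔻 → ℂ} (hf : IsHolomorphic f) (hg : IsHolomorphic g) {z : ℂ}
    (hz : z ∈ ball (0 : ℂ) 1) :
    deriv (zeroExtend (f - g)) z = deriv (zeroExtend f) z - deriv (zeroExtend g) z := by
  rw [zeroExtend_sub, deriv_sub (hf.differentiableAt hz) (hg.differentiableAt hz)]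

theorem IsHolomorphic.contDiffAt_zero {f : 𝔻 → ℂ} (hf : IsHolomorphic f) (n : ℕ) :
    ContDiffAt ℂ n (zeroExtend f) 0 :=
  (DifferentiableOn.analyticAt hf (ball_mem_nhds 0 one_pos)).contDiffAt

theorem dirichletIntegral_le_of_tendsto {u : ℕ → 𝔻 → ℂ} {g : 𝔻 → ℂ} {C : ℝ≥0∞}
    (hu : ∀ z ∈ ball (0 : ℂ) 1,
      Tendsto (fun n => deriv (zeroExtend (u n)) z) atTop (𝓝 (deriv (zeroExtend g) z)))
    (hC : ∀ᶠ n in atTop, dirichletIntegral (u n) ≤ C) : dirichletIntegral g ≤ C :=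
  calc dirichletIntegral g
      = ∫⁻ z, liminf (fun n => ‖deriv (zeroExtend (u n)) z‖ₑ ^ 2) atTop ∂areaMeasure := by
        refine lintegral_congr_ae ?_
        filter_upwards [ae_mem_ball] with z hz
        exact (((ENNReal.continuous_pow 2).tendsto _).comp (hu z hz).enorm).liminf_eq.symm
    _ ≤ liminf (fun n => dirichletIntegral (u n)) atTop :=
        lintegral_liminf_le fun n => (measurable_deriv _).enorm.pow_const 2
    _ ≤ C := liminf_le_of_frequently_le' hC.frequently

namespace DirichletSpace

theorem coe_sub (f g : DirichletSpace) : ((f - g : DirichletSpace) : 𝔻 → ℂ) = f - g := rfl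

theorem enorm_sq (f : DirichletSpace) : ‖f‖ₑ ^ 2 = ‖f 0‖ₑ ^ 2 + dirichletIntegral f := by
  have hsq : ‖f‖ ^ 2 = ‖f 0‖ ^ 2 + (dirichletIntegral f).toReal := Real.sq_sqrt (by positivity)
  rw [← ofReal_norm, ← ENNReal.ofReal_pow (norm_nonneg _), hsq,
    ENNReal.ofReal_add (by positivity) (by positivity), ENNReal.ofReal_toReal f.memDirichlet.2.ne,
    ENNReal.ofReal_pow (norm_nonneg _), ofReal_norm]

theorem dirichletIntegral_le (f : DirichletSpace) : dirichletIntegral f ≤ ‖f‖ₑ ^ 2 :=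
  le_add_self.trans_eq f.enorm_sq.symm

/-- The functional `f ↦ f⁽ⁿ⁾(0) / n!`. -/
def coeff (n : ℕ) : DirichletSpace →ₗ[ℂ] ℂ where
  toFun f := taylorCoeff (zeroExtend f) 0 n
  map_add' f g := by
    change taylorCoeff (zeroExtend ((f : 𝔻 → ℂ) + g)) 0 n = _
    rw [zeroExtend_add, taylorCoeff, iteratedDeriv_add (f.memDirichlet.1.contDiffAt_zero n)
      (g.memDirichlet.1.contDiffAt_zero n), mul_add]
    rfl
  map_smul' c f := by
    change taylorCoeff (zeroExtend (c • (f : 𝔻 → ℂ))) 0 n = _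
    rw [zeroExtend_smul, taylorCoeff, iteratedDeriv_const_smul_field, mul_smul_comm]
    rfl

theorem coeff_apply (n : ℕ) (f : DirichletSpace) : coeff n f = taylorCoeff (zeroExtend f) 0 n := rfl

theorem coeff_zero (f : DirichletSpace) : coeff 0 f = f 0 := by
  simp [coeff_apply, taylorCoeff, ← zeroExtend_coe f]

theorem taylorCoeff_deriv_eq (n : ℕ) (f : DirichletSpace) :
    taylorCoeff (deriv (zeroExtend f)) 0 n = (n + 1) * coeff (n + 1) f :=
  taylorCoeff_deriv _ _ _

theorem norm_coeff_le (n : ℕ) (f : DirichletSpace) : ‖coeff n f‖ ≤ ‖f‖ := by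
  rw [← enorm_le_iff_norm_le, ← ENNReal.pow_le_pow_left_iff two_ne_zero]
  cases n with
  | zero =>
    rw [coeff_zero, enorm_sq]
    exact le_self_add
  | succ n =>
    have hn : ((n : ℝ≥0∞) + 1) ≠ ⊤ := by finiteness
    calc ‖coeff (n + 1) f‖ₑ ^ 2 ≤ (n + 1) * ‖coeff (n + 1) f‖ₑ ^ 2 :=
        le_mul_of_one_le_left zero_le le_add_self
      _ = ‖taylorCoeff (deriv (zeroExtend f)) 0 n‖ₑ ^ 2 / (n + 1) := by
        rw [ENNReal.eq_div_iff (by positivity) hn, taylorCoeff_deriv_eq, enorm_mul,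
          enorm_natCast_add_one]
        ring
      _ ≤ dirichletIntegral f :=
        (ENNReal.le_tsum n).trans (tsum_taylorCoeff_deriv_le_dirichletIntegral f.memDirichlet.1)
      _ ≤ ‖f‖ₑ ^ 2 := f.dirichletIntegral_le

theorem norm_zeroExtend_le (f : DirichletSpace) {z : ℂ} (hz : ‖z‖ < 1) :
    ‖zeroExtend f z‖ ≤ ‖f‖ * (1 - ‖z‖)⁻¹ := by
  rw [← (hasSum_taylorCoeff f.memDirichlet.1 (mem_ball_zero_iff.2 hz)).tsum_eq]
  refine tsum_of_norm_bounded ((hasSum_geometric_of_lt_one (norm_nonneg z) hz).mul_left ‖f‖)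
    fun n => ?_
  rw [sub_zero, norm_mul, norm_pow]
  gcongr
  exact norm_coeff_le n f

/-- Evaluation at a point of the disc, as a continuous linear functional. -/
def eval (z : 𝔻) : DirichletSpace →L[ℂ] ℂ :=
  LinearMap.mkContinuous
    { toFun f := f z
      map_add' _ _ := rfl
      map_smul' _ _ := rfl }
    (1 - ‖(z : ℂ)‖)⁻¹ fun f => by
      change ‖f z‖ ≤ _
      simpa only [zeroExtend_coe, mul_comm ‖f‖] using f.norm_zeroExtend_le z.norm_lt_one

theorem uniformCauchySeqOn_closedBall {u : ℕ → DirichletSpace} (hu : CauchySeq u) {r : ℝ}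
    (hr : r < 1) : UniformCauchySeqOn (fun n => zeroExtend (u n)) atTop (closedBall 0 r) := by
  have hr' : 0 < 1 - r := sub_pos.2 hr
  refine Metric.uniformCauchySeqOn_iff.2 fun ε hε => ?_
  obtain ⟨N, hN⟩ := Metric.cauchySeq_iff.1 hu (ε * (1 - r)) (by positivity)
  refine ⟨N, fun m hm n hn z hz => ?_⟩
  rw [mem_closedBall_zero_iff] at hz
  calc dist (zeroExtend (u m) z) (zeroExtend (u n) z) = ‖zeroExtend (u m - u n :) z‖ := by
        rw [dist_eq_norm, ← Pi.sub_apply, ← zeroExtend_sub]; rfl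
    _ ≤ ‖u m - u n‖ * (1 - ‖z‖)⁻¹ := norm_zeroExtend_le _ (hz.trans_lt hr)
    _ ≤ ‖u m - u n‖ * (1 - r)⁻¹ := by gcongr
    _ < ε := by simpa only [← div_eq_mul_inv, div_lt_iff₀ hr', dist_eq_norm] using hN m hm n hn

theorem exists_tendstoLocallyUniformlyOn {u : ℕ → DirichletSpace} (hu : CauchySeq u) :
    ∃ g : 𝔻 → ℂ,
      TendstoLocallyUniformlyOn (fun n => zeroExtend (u n)) (zeroExtend g) atTop (ball 0 1) := by
  have hlim : ∀ z : 𝔻, ∃ w, Tendsto (fun n => u n z) atTop (𝓝 w) := fun z => by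
    refine cauchySeq_tendsto_of_complete ?_
    simpa only [zeroExtend_coe] using (uniformCauchySeqOn_closedBall hu z.norm_lt_one).cauchySeq
      (mem_closedBall_zero_iff.2 le_rfl)
  choose g hg using hlim
  refine ⟨g, (tendstoLocallyUniformlyOn_iff_forall_isCompact isOpen_ball).2 fun K hK hKc => ?_⟩
  obtain ⟨r, hr, hKr⟩ := exists_lt_subset_ball hKc.isClosed hK
  refine ((uniformCauchySeqOn_closedBall hu hr).mono
    (hKr.trans ball_subset_closedBall)).tendstoUniformlyOn_of_tendsto fun z hz => ?_
  have hz' : ‖z‖ < 1 := mem_ball_zero_iff.1 (hK hz)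
  simpa only [zeroExtend_of_mem _ hz'] using hg _

theorem eventually_dirichletIntegral_sub_le {u : ℕ → DirichletSpace} (hu : CauchySeq u) {g : 𝔻 → ℂ}
    (hg : TendstoLocallyUniformlyOn (fun n => zeroExtend (u n)) (zeroExtend g) atTop (ball 0 1))
    {ε : ℝ≥0∞} (hε : 0 < ε) : ∀ᶠ n in atTop, dirichletIntegral (u n - g) ≤ ε := by
  have hholo : ∀ᶠ n in atTop, DifferentiableOn ℂ (zeroExtend (u n)) (ball 0 1) :=
    Eventually.of_forall fun n => (u n).memDirichlet.1
  have hcauchy : Tendsto (fun p : ℕ × ℕ => ‖u p.1 - u p.2‖ₑ ^ 2) (atTop ×ˢ atTop) (𝓝 0) := by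
    have h := ENNReal.tendsto_ofReal (cauchySeq_iff_tendsto_dist_atTop_0.1 hu)
    simp only [← edist_dist, edist_eq_enorm_sub, ENNReal.ofReal_zero] at h
    simpa only [prod_atTop_atTop_eq, zero_pow two_ne_zero, Function.comp_def] using
      ((ENNReal.continuous_pow 2).tendsto 0).comp h
  filter_upwards [((ENNReal.tendsto_nhds_zero.1 hcauchy) ε hε).curry] with n hn
  refine dirichletIntegral_le_of_tendsto (u := fun m => u n - u m) (fun z hz => ?_)
    (hn.mono fun m hm => (dirichletIntegral_le (u n - u m)).trans hm)
  simp only [deriv_zeroExtend_sub (u n).memDirichlet.1 (u _).memDirichlet.1 hz,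
    deriv_zeroExtend_sub (u n).memDirichlet.1 (hg.differentiableOn hholo isOpen_ball) hz]
  exact ((hg.deriv hholo isOpen_ball).tendsto_at hz).const_sub _

instance : CompleteSpace DirichletSpace := by
  refine Metric.complete_of_cauchySeq_tendsto fun u hu => ?_
  obtain ⟨g, hg⟩ := exists_tendstoLocallyUniformlyOn hu
  have hholo : IsHolomorphic g :=
    hg.differentiableOn (Eventually.of_forall fun n => (u n).memDirichlet.1) isOpen_ball
  have hsub : ∀ ε > 0, ∀ᶠ n in atTop, dirichletIntegral (u n - g) ≤ ε := fun ε hε =>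
    eventually_dirichletIntegral_sub_le hu hg hε
  have hmem : g ∈ dirichletSubmodule := by
    obtain ⟨n, hn⟩ := (hsub 1 one_pos).exists
    have hdiff : (u n : 𝔻 → ℂ) - g ∈ dirichletSubmodule := by
      refine ⟨?_, hn.trans_lt ENNReal.one_lt_top⟩
      rw [IsHolomorphic, zeroExtend_sub]
      exact (u n).memDirichlet.1.sub hholo
    exact (dirichletSubmodule.sub_mem_iff_right (u n).2).1 hdiff
  let G : DirichletSpace := ⟨g, hmem⟩
  refine ⟨G, ?_⟩
  have hzero : Tendsto (fun n => ‖u n 0 - g 0‖ₑ ^ 2) atTop (𝓝 0) := by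
    have h := (hg.tendsto_at (mem_ball_self one_pos)).sub_const (zeroExtend g 0)
    rw [sub_self, ← Complex.UnitDisc.coe_zero] at h
    simp only [zeroExtend_coe] at h
    simpa [Function.comp_def] using (ENNReal.continuous_pow 2).tendsto _ |>.comp h.enorm
  have hsq : Tendsto (fun n => ‖u n - G‖ₑ ^ 2) atTop (𝓝 0) := by
    simpa only [enorm_sq, coe_sub, Pi.sub_apply, add_zero] using
      hzero.add (ENNReal.tendsto_nhds_zero.2 hsub)
  refine tendsto_iff_edist_tendsto_0.2 (ENNReal.tendsto_nhds_zero.2 fun ε hε => ?_)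
  filter_upwards [ENNReal.tendsto_nhds_zero.1 hsq (ε ^ 2) (by positivity)] with n hn
  rwa [edist_eq_enorm_sub, ← ENNReal.pow_le_pow_left_iff two_ne_zero]

end DirichletSpace

end DirichletNorm

section CompositionOperator

variable {φ : 𝔻 → 𝔻}

theorem compositionBounded_of_forall_memDirichlet
    (h : ∀ f : DirichletSpace, MemDirichlet fun z => f (φ z)) : CompositionBounded φ := by
  let T : DirichletSpace →ₗ[ℂ] DirichletSpace :=
    { toFun f := ⟨fun z => f (φ z), h f⟩
      map_add' _ _ := rfl
      map_smul' _ _ := rfl }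
  have hclosed : ∀ (u : ℕ → DirichletSpace) (f g), Tendsto u atTop (𝓝 f) →
      Tendsto (T ∘ u) atTop (𝓝 g) → g = T f := fun u f g hf hg =>
    Subtype.ext <| funext fun z =>
      tendsto_nhds_unique ((DirichletSpace.eval z).continuous.tendsto g |>.comp hg)
        ((DirichletSpace.eval (φ z)).continuous.tendsto f |>.comp hf)
  exact ⟨⟨T, T.continuous_of_seq_closed_graph hclosed⟩, fun _ _ => rfl⟩

theorem compositionBounded_of_dirichletIntegral_pow_le (hφ : IsHolomorphic fun z => (φ z : ℂ))
    {M : ℝ≥0∞} (hM_lt : M < ∞) (hM : ∀ n, dirichletIntegral (fun z => (φ z : ℂ) ^ (n + 1)) ≤ M) :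
    CompositionBounded φ := by
  refine compositionBounded_of_forall_memDirichlet fun f => ⟨f.memDirichlet.1.comp hφ, ?_⟩
  calc dirichletIntegral (fun z => f (φ z)) ≤ 16 * M * dirichletIntegral f :=
        dirichletIntegral_comp_le (N := 0) f.memDirichlet.1 hφ (fun n _ => hM n) (by simp)
    _ < ∞ := ENNReal.mul_lt_top (ENNReal.mul_lt_top (by simp) hM_lt) f.memDirichlet.2

theorem isCompactOperator_of_tendsto_dirichletIntegral_pow (hφ : IsHolomorphic fun z => (φ z : ℂ))
    (hlim : Tendsto (fun n => dirichletIntegral fun z => (φ z : ℂ) ^ (n + 1)) atTop (𝓝 0))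
    {T : DirichletSpace →L[ℂ] DirichletSpace} (hT : IsCompositionOperator φ T) :
    IsCompactOperator T := by
  refine isCompactOperator_of_forall_exists_coFG fun ε hε => ?_
  lift ε to ℝ≥0 using hε.le
  have hε_sq : (0 : ℝ≥0∞) < (ε : ℝ≥0∞) ^ 2 / 16 :=
    ENNReal.div_pos (pow_ne_zero 2 (ENNReal.coe_ne_zero.2 (NNReal.coe_pos.1 hε).ne')) (by simp)
  obtain ⟨N, hN⟩ := eventually_atTop.1 (ENNReal.tendsto_nhds_zero.1 hlim _ hε_sq)
  let A : DirichletSpace →ₗ[ℂ] ℂ × (Fin N → ℂ) :=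
    (DirichletSpace.eval (φ 0)).toLinearMap.prod
      (LinearMap.pi fun i => DirichletSpace.coeff (i + 1))
  refine ⟨LinearMap.ker A, Submodule.CoFG.ker A, fun f hf => ?_⟩
  have hf_zero : f (φ 0) = 0 := congrArg Prod.fst hf
  have hf_coeff : ∀ n < N, taylorCoeff (deriv (zeroExtend f)) 0 n = 0 := fun n hn => by
    rw [f.taylorCoeff_deriv_eq, show DirichletSpace.coeff (n + 1) f = 0 from
      congrFun (congrArg Prod.snd hf) ⟨n, hn⟩, mul_zero]
  have hTf : (T f : 𝔻 → ℂ) = fun z => f (φ z) := funext (hT f)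
  suffices ‖T f‖ₑ ^ 2 ≤ (ε * ‖f‖ₑ) ^ 2 by
    rw [ENNReal.pow_le_pow_left_iff two_ne_zero] at this
    simpa only [enorm_eq_nnnorm, ← ENNReal.coe_mul, ENNReal.coe_le_coe, ← NNReal.coe_le_coe,
      NNReal.coe_mul, coe_nnnorm] using this
  calc ‖T f‖ₑ ^ 2 = dirichletIntegral fun z => f (φ z) := by
        simp [DirichletSpace.enorm_sq, hTf, hf_zero]
    _ ≤ 16 * ((ε : ℝ≥0∞) ^ 2 / 16) * dirichletIntegral f :=
        dirichletIntegral_comp_le f.memDirichlet.1 hφ hN hf_coeff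
    _ = ε ^ 2 * dirichletIntegral f := by rw [ENNReal.mul_div_cancel (by simp) (by simp)]
    _ ≤ ε ^ 2 * ‖f‖ₑ ^ 2 := by gcongr; exact f.dirichletIntegral_le
    _ = (ε * ‖f‖ₑ) ^ 2 := (mul_pow _ _ _).symm

theorem compositionCompact_of_tendsto_dirichletIntegral_pow
    (hφ : MemDirichlet fun z => (φ z : ℂ))
    (hlim : Tendsto (fun n => dirichletIntegral fun z => (φ z : ℂ) ^ (n + 1)) atTop (𝓝 0)) :
    CompositionCompact φ := by
  have hfin : ∀ n : ℕ, dirichletIntegral (fun z => (φ z : ℂ) ^ (n + 1)) ≠ ∞ := fun n =>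
    ((dirichletIntegral_pow_succ_le hφ.1 n).trans_lt
      (ENNReal.mul_lt_top (by finiteness) hφ.2)).ne
  obtain ⟨M, hM_lt, hM⟩ := exists_lt_top_forall_le_of_tendsto hfin ENNReal.zero_ne_top hlim
  obtain ⟨T, hT⟩ := compositionBounded_of_dirichletIntegral_pow_le hφ.1 hM_lt hM
  exact ⟨T, hT, isCompactOperator_of_tendsto_dirichletIntegral_pow hφ.1 hlim hT⟩

end CompositionOperator

end DirichletComposition

end

theorem mainTheorem2 (φ : Complex.UnitDisc → Complex.UnitDisc)
    (hφ : DirichletComposition.MemDirichlet (fun z => (φ z : ℂ))) :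
    ((⨆ (n : ℕ) (_ : 1 ≤ n),
        DirichletComposition.dirichletIntegral (fun z => (φ z : ℂ) ^ n)) < (⊤ : ENNReal) →
      DirichletComposition.CompositionBounded φ) ∧
    (Filter.Tendsto
        (fun n : ℕ => DirichletComposition.dirichletIntegral (fun z => (φ z : ℂ) ^ n))
        Filter.atTop (nhds 0) →
      DirichletComposition.CompositionCompact φ) := by
  refine ⟨fun hsup => ?_, fun hlim => ?_⟩
  · exact DirichletComposition.compositionBounded_of_dirichletIntegral_pow_le hφ.1 hsup fun n =>
      le_iSup₂ (f := fun (n : ℕ) (_ : 1 ≤ n) =>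
        DirichletComposition.dirichletIntegral fun z => (φ z : ℂ) ^ n) (n + 1) le_add_self
  · exact DirichletComposition.compositionCompact_of_tendsto_dirichletIntegral_pow hφ
      (hlim.comp (Filter.tendsto_add_atTop_nat 1))
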